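/- Let $m\ge 2$ and let $M$ be a smooth $n$-dimensional manifold. An $m$-th root metric on $M$ is given by a smooth symmetric covariant $m$-tensor field with components $a_{i_1\dots i_m}(x)$ in local coordinates. Put $T(x,y)=a_{i_1\dots i_m}(x)\,y^{i_1}\cdots y^{i_m}$ and $F=|T|^{1/m}$ (so $F=\sqrt[m]{T}$ where $T\ge 0$). It is assumed that $T(x,\cdot)$ is not identically zero for any $x$ and that $g_{ij}=\tfrac12\,\partial^2F^2/\partial y^i\partial y^j$ is nondegenerate at every $(x,y)$ with $T(x,y)\neq 0$; no positive definiteness is required. The unit-speed geodesics are the $C^2$ curves $x(t)$ with $F(x,x')=1$ which satisfy the Euler–Lagrange equations $\frac{d}{dt}\frac{\partial F}{\partial y^i}(x,x')=\frac{\partial F}{\partial x^i}(x,x')$. The metric is called projectively flat if around every point of $M$ there are local coordinates in which the geodesics are straight lines (as point sets). Let $$\gamma_{p\,j_1\dots j_m}=\frac{1}{m(m-1)}\Big(\sum_{(j_1,\dots,j_m)}\frac{\partial a_{p j_2\dots j_m}}{\partial x^{j_1}}-\frac{\partial a_{j_1\dots j_m}}{\partial x^p}\Big),$$ where the sum is cyclic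 in $j_1,\dots,j_m$. **Theorem.** An $m$-th root metric on $M$ is projectively flat if and only if around every point of $M$ there are local coordinates in which $$m\sum a_{i_1 i_2\dots i_m}\,\gamma_{j\,j_1\dots j_m}=\sum a_{j i_2\dots i_m}\,\frac{\partial a_{j_1\dots j_m}}{\partial x^{i_1}}\qquad\text{for all } j,i_1,\dots,i_m,j_1,\dots,j_m\in\{1,\dots,n\},\tag{4.3}$$ where $\sum$ denotes symmetrization over the $2m$ indices $i_1,\dots,i_m,j_1,\dots,j_m$. More precisely, in the domain of any given coordinate chart, the geodesics are straight lines in these coordinates if and only if (4.3) holds in these coordinates at every point of the domain. -/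

import Mathlib

open scoped Manifold ContDiff

noncomputable section

namespace MthRoot

/-- The coordinate space `ℝⁿ`. -/
abbrev E (n : ℕ) : Type := EuclideanSpace ℝ (Fin n)

/-- The partial derivative `∂f/∂xⁱ` at `u`. -/
def pd {n : ℕ} (i : Fin n) (f : E n → ℝ) (u : E n) : ℝ :=
  fderiv ℝ f u (EuclideanSpace.single i 1)

/-! ### Local expressions

`a I u` is the coefficient `a_{i₁…i_m}` at the coordinate point `u`, where `I = (i₁,…,i_m)`. -/

/-- `T(x,y) = a_{i₁…i_m}(x) y^{i₁} ⋯ y^{i_m}`. -/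
def T {m n : ℕ} (a : (Fin m → Fin n) → E n → ℝ) (u y : E n) : ℝ :=
  ∑ I : Fin m → Fin n, a I u * ∏ k, y (I k)

/-- The `m`-th root `F` of `T`. In an indefinite metric the directions with `T < 0` are measured
by the root of `|T|`; `F` is smooth on the open cone `T ≠ 0`. -/
def F {m n : ℕ} (a : (Fin m → Fin n) → E n → ℝ) (u y : E n) : ℝ :=
  |T a u y| ^ (1 / (m : ℝ))

/-- The Finsler metric tensor `g_{ij} = ½ ∂²F²/∂yⁱ∂yʲ`. -/
def g {m n : ℕ} (a : (Fin m → Fin n) → E n → ℝ) (u y : E n) : Matrix (Fin n) (Fin n) ℝ :=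
  Matrix.of fun i j => (1 / 2) * pd i (fun z => pd j (fun w => F a u w ^ 2) z) y

/-- The generalized Christoffel symbols with lowered index,
`γ_{p j₁…j_m} = (1/(m(m-1))) (∑_{cyclic} ∂_{j₁} a_{p j₂…j_m} - ∂_p a_{j₁…j_m})`.
The term of the cyclic sum that differentiates along `j_s` involves the coefficient whose indices
are `p` and all the `j`'s except `j_s`; as `a` is symmetric, `p` may stand in the place of `j_s`. -/
def gamma {m n : ℕ} (a : (Fin m → Fin n) → E n → ℝ) (p : Fin n) (J : Fin m → Fin n) (u : E n) :
    ℝ :=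
  (1 / ((m : ℝ) * ((m : ℝ) - 1))) *
    ((∑ s : Fin m, pd (J s) (a (Function.update J s p)) u) - pd p (a J) u)

/-- `x`, restricted to the open interval `J`, is a unit-speed geodesic of `F` in the coordinate
domain `U`: a `C²` curve with `F(x, x') = 1` which solves the Euler-Lagrange equations
`d/dt (∂F/∂yⁱ (x, x')) = ∂F/∂xⁱ (x, x')`. -/
structure IsUnitSpeedGeodesic {m n : ℕ} (a : (Fin m → Fin n) → E n → ℝ) (U : Set (E n))
    (J : Set ℝ) (x : ℝ → E n) : Prop where
  mapsTo : Set.MapsTo x J U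
  contDiffOn : ContDiffOn ℝ 2 x J
  unitSpeed : ∀ t ∈ J, F a (x t) (deriv x t) = 1
  eulerLagrange : ∀ t ∈ J, ∀ i : Fin n,
    HasDerivAt (fun s => pd i (fun y => F a (x s) y) (deriv x s))
      (pd i (fun u => F a u (deriv x t)) (x t)) t

/-- In the coordinate domain `U`, all geodesics are straight lines (as point sets). -/
def GeodesicsStraight {m n : ℕ} (a : (Fin m → Fin n) → E n → ℝ) (U : Set (E n)) : Prop :=
  ∀ (J : Set ℝ) (x : ℝ → E n), IsOpen J → J.OrdConnected →
    IsUnitSpeedGeodesic a U J x → Collinear ℝ (x '' J)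

/-- The symmetrized coefficient identity on `U`:
`m ∑ a_{i₁…i_m} γ_{j j₁…j_m} = ∑ a_{j i₂…i_m} ∂_{i₁} a_{j₁…j_m}` for all indices, where `∑` is the
sum over all permutations of the `2m` indices `i₁,…,i_m,j₁,…,j_m`. -/
def CoefficientIdentity {m n : ℕ} [NeZero m] (a : (Fin m → Fin n) → E n → ℝ) (U : Set (E n)) :
    Prop :=
  ∀ u ∈ U, ∀ (j : Fin n) (I J : Fin m → Fin n),
    (m : ℝ) * ∑ σ : Equiv.Perm (Fin m ⊕ Fin m),
        a (fun k => Sum.elim I J (σ (Sum.inl k))) u *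
          gamma a j (fun k => Sum.elim I J (σ (Sum.inr k))) u
      = ∑ σ : Equiv.Perm (Fin m ⊕ Fin m),
        a (Function.update (fun k => Sum.elim I J (σ (Sum.inl k))) 0 j) u *
          pd (Sum.elim I J (σ (Sum.inl 0)))
            (a (fun k => Sum.elim I J (σ (Sum.inr k)))) u

/-! ### Metrics on a manifold -/

/-- The components `a_{i₁…i_m}` of a covariant `m`-tensor field in the coordinates of a chart `φ`:
its values on the coordinate vector fields `∂_i = d(φ⁻¹)(e_i)`. -/
def localCoeff {m n : ℕ} {M : Type*} [TopologicalSpace M] [ChartedSpace (E n) M]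
    (A : ∀ p : M, MultilinearMap ℝ (fun _ : Fin m => TangentSpace (𝓡 n) p) ℝ)
    (φ : OpenPartialHomeomorph M (E n)) (I : Fin m → Fin n) (u : E n) : ℝ :=
  A (φ.symm u) fun k =>
    mfderiv (𝓡 n) (𝓡 n) φ.symm u (EuclideanSpace.single (I k) (1 : ℝ) : E n)

/-- An `m`-th root metric on `M`: a smooth symmetric covariant `m`-tensor field, nowhere zero,
such that `g_{ij}` is nondegenerate in all directions in which `F` is smooth (`T ≠ 0`). -/
structure Metric (m n : ℕ) (M : Type*) [TopologicalSpace M] [ChartedSpace (E n) M] where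
  tensor : ∀ p : M, MultilinearMap ℝ (fun _ : Fin m => TangentSpace (𝓡 n) p) ℝ
  symmetric : ∀ (p : M) (σ : Equiv.Perm (Fin m)) (v : Fin m → TangentSpace (𝓡 n) p),
    tensor p (fun k => v (σ k)) = tensor p v
  smooth : ∀ φ ∈ IsManifold.maximalAtlas (𝓡 n) ∞ M, ∀ I : Fin m → Fin n,
    ContDiffOn ℝ ∞ (localCoeff tensor φ I) φ.target
  nonzero : ∀ φ ∈ IsManifold.maximalAtlas (𝓡 n) ∞ M, ∀ u ∈ φ.target,
    ∃ y : E n, T (localCoeff tensor φ) u y ≠ 0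
  nondegenerate : ∀ φ ∈ IsManifold.maximalAtlas (𝓡 n) ∞ M, ∀ u ∈ φ.target, ∀ y : E n,
    T (localCoeff tensor φ) u y ≠ 0 → (g (localCoeff tensor φ) u y).det ≠ 0

/-- The coefficients of the metric in a chart. -/
def Metric.coeff {m n : ℕ} {M : Type*} [TopologicalSpace M] [ChartedSpace (E n) M]
    (A : Metric m n M) (φ : OpenPartialHomeomorph M (E n)) : (Fin m → Fin n) → E n → ℝ :=
  localCoeff A.tensor φ

/-- Projective flatness: around every point there are coordinates in which the geodesics are
straight lines. -/
def Metric.ProjectivelyFlat {m n : ℕ} {M : Type*} [TopologicalSpace M] [ChartedSpace (E n) M]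
    (A : Metric m n M) : Prop :=
  ∀ p : M, ∃ φ ∈ IsManifold.maximalAtlas (𝓡 n) ∞ M,
    p ∈ φ.source ∧ GeodesicsStraight (A.coeff φ) φ.target

end MthRoot

end

/-!
The theorem is proved in one chart at a time, where it concerns a symmetric array `a` of smooth
functions on an open set `U ⊆ ℝⁿ`. Write `T_i` for `∂T/∂yⁱ`, `T_{xⁱ}` for `∂T/∂xⁱ`, and a
subscript `0` for the contraction `yᵏ ∂/∂xᵏ`. Both sides of the equivalence are compared with
Hamel's condition (`HamelAt`)

  `m T (T_{0i} - T_{xⁱ}) = (m - 1) T_i T_0`,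

which is `yᵏ ∂²F/∂xᵏ∂yⁱ = ∂F/∂xⁱ` for `F = |T|^{1/m}`, cleared of denominators.

*Coefficient identity.* Contracting the tensors in the identity with `y` turns `γ_{j j₁…j_m}` into
`(T_{0j} - T_{xʲ}) / (m (m - 1))` (`form_gamma`) and the right-hand side into `T_j T_0 / m`
(`sum_coeff_update_mul_pd`). By polarization (`sum_perm_eq_zero_iff`) a symmetrized array is zero if
and only if its polynomial is, so the identity is Hamel's condition for all `y`
(`coefficientIdentity_iff`).

*Geodesics.* Along a curve of unit speed `T = ±1`, so the Euler-Lagrange equations of `F` reduce to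
those of `T`, namely `T_{ik} zᵏ = T_{xⁱ} - T_{0i}` for the acceleration `z` (`eulerLagrange_iff`).
Since `T_{ik} yᵏ = (m - 1) T_i`, nondegeneracy of `g` implies that of `T_{ik}` where `T ≠ 0`
(`eq_zero_of_formDeriv₂_eq_zero`), and contracting the equation with `y` gives `T_k zᵏ = -T_0`. It
follows that, where `T ≠ 0`, Hamel's condition at `(x, y)` holds if and only if the acceleration of
the geodesic through `x` with velocity `y` is a multiple of `y` (`HamelAt.exists_eq_smul`,
`GeodesicEqAt.hamelAt`).

If the acceleration is everywhere a multiple of the velocity, then the curve is straight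
(`collinear_of_acceleration`). Conversely, the Picard-Lindelöf theorem gives a unit-speed geodesic
through each point in each direction with `|T| = 1` (`exists_geodesic`); straightness then yields
Hamel's condition in these directions, by homogeneity wherever `T ≠ 0`, and by polynomiality in `y`
everywhere (`hamelAt_of_T_ne_zero`).
-/

open scoped Manifold ContDiff

noncomputable section

namespace MthRoot

open Finset

variable {m n : ℕ}

/-! ### Forms given by coefficient arrays -/

/-- The homogeneous form `∑ c_{i₁…i_m} y^{i₁} ⋯ y^{i_m}` with coefficient array `c`. -/
def form {m n : ℕ} (c : (Fin m → Fin n) → ℝ) (y : E n) : ℝ :=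
  ∑ I : Fin m → Fin n, c I * ∏ k, y (I k)

/-- The derivative of `form c` at `y` in the direction `w`. -/
def formDeriv {m n : ℕ} (c : (Fin m → Fin n) → ℝ) (y w : E n) : ℝ :=
  ∑ I : Fin m → Fin n, c I * ∑ s, (∏ k ∈ univ.erase s, y (I k)) * w (I s)

/-- The second derivative of `form c` at `y` in the directions `w` and `w'`. -/
def formDeriv₂ {m n : ℕ} (c : (Fin m → Fin n) → ℝ) (y w w' : E n) : ℝ :=
  ∑ I : Fin m → Fin n, c I *
    ∑ s, (∑ t ∈ univ.erase s, (∏ k ∈ (univ.erase s).erase t, y (I k)) * w' (I t)) * w (I s)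

theorem hasDerivAt_coord {y : ℝ → E n} {y' : E n} {t : ℝ} (hy : HasDerivAt y y' t) (i : Fin n) :
    HasDerivAt (fun s => y s i) (y' i) t :=
  (EuclideanSpace.proj i : E n →L[ℝ] ℝ).hasFDerivAt.comp_hasDerivAt t hy

theorem hasDerivAt_form {c : ℝ → (Fin m → Fin n) → ℝ} {c' : (Fin m → Fin n) → ℝ}
    {y : ℝ → E n} {y' : E n} {t : ℝ} (hc : ∀ I, HasDerivAt (fun s => c s I) (c' I) t)
    (hy : HasDerivAt y y' t) :
    HasDerivAt (fun s => form (c s) (y s)) (form c' (y t) + formDeriv (c t) (y t) y') t := by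
  unfold form formDeriv
  rw [← sum_add_distrib]
  refine HasDerivAt.fun_sum fun I _ => ?_
  exact (hc I).mul (HasDerivAt.fun_finsetProd fun k _ => hasDerivAt_coord hy (I k))

theorem hasDerivAt_formDeriv {c : ℝ → (Fin m → Fin n) → ℝ} {c' : (Fin m → Fin n) → ℝ}
    {y : ℝ → E n} {y' : E n} {t : ℝ} (hc : ∀ I, HasDerivAt (fun s => c s I) (c' I) t)
    (hy : HasDerivAt y y' t) (w : E n) :
    HasDerivAt (fun s => formDeriv (c s) (y s) w)
      (formDeriv c' (y t) w + formDeriv₂ (c t) (y t) w y') t := by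
  unfold formDeriv formDeriv₂
  rw [← sum_add_distrib]
  refine HasDerivAt.fun_sum fun I _ => (hc I).mul ?_
  refine HasDerivAt.fun_sum fun s _ => ?_
  exact (HasDerivAt.fun_finsetProd fun k _ => hasDerivAt_coord hy (I k)).mul_const _

theorem formDeriv_add (c : (Fin m → Fin n) → ℝ) (y w w' : E n) :
    formDeriv c y (w + w') = formDeriv c y w + formDeriv c y w' := by
  simp only [formDeriv, PiLp.add_apply, mul_add, sum_add_distrib]

theorem formDeriv_smul (c : (Fin m → Fin n) → ℝ) (y w : E n) (r : ℝ) :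
    formDeriv c y (r • w) = r * formDeriv c y w := by
  simp only [formDeriv, PiLp.smul_apply, smul_eq_mul, mul_sum]
  exact sum_congr rfl fun I _ => sum_congr rfl fun s _ => by ring

theorem formDeriv₂_add (c : (Fin m → Fin n) → ℝ) (y v w w' : E n) :
    formDeriv₂ c y v (w + w') = formDeriv₂ c y v w + formDeriv₂ c y v w' := by
  simp only [formDeriv₂, PiLp.add_apply, mul_add, add_mul, sum_add_distrib]

theorem formDeriv₂_smul (c : (Fin m → Fin n) → ℝ) (y v w : E n) (r : ℝ) :
    formDeriv₂ c y v (r • w) = r * formDeriv₂ c y v w := by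
  simp only [formDeriv₂, PiLp.smul_apply, smul_eq_mul, mul_sum, sum_mul]
  exact sum_congr rfl fun I _ => sum_congr rfl fun s _ => sum_congr rfl fun t _ => by ring

theorem formDeriv₂_comm (c : (Fin m → Fin n) → ℝ) (y w w' : E n) :
    formDeriv₂ c y w w' = formDeriv₂ c y w' w := by
  unfold formDeriv₂
  refine sum_congr rfl fun I _ => congrArg _ ?_
  simp only [sum_mul]
  rw [sum_comm' (t' := univ) (s' := fun t => univ.erase t)]
  · refine sum_congr rfl fun s _ => sum_congr rfl fun t _ => ?_
    rw [erase_right_comm]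
    ring
  · intro s t
    simp [ne_comm]

/-- Euler's identity for the form. -/
theorem formDeriv_self (c : (Fin m → Fin n) → ℝ) (y : E n) :
    formDeriv c y y = m * form c y := by
  unfold formDeriv form
  rw [mul_sum]
  refine sum_congr rfl fun I _ => ?_
  rw [sum_congr rfl fun s _ => prod_erase_mul univ (fun k => y (I k)) (mem_univ s)]
  simp only [sum_const, card_univ, Fintype.card_fin, nsmul_eq_mul]
  ring

/-- Euler's identity for the first derivative of the form. -/
theorem formDeriv₂_self_left (c : (Fin m → Fin n) → ℝ) (y w : E n) :
    formDeriv₂ c y y w = ((m : ℝ) - 1) * formDeriv c y w := by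
  unfold formDeriv₂ formDeriv
  rw [mul_sum]
  refine sum_congr rfl fun I _ => ?_
  have h : ∀ s t : Fin m, t ∈ univ.erase s →
      (∏ k ∈ (univ.erase s).erase t, y (I k)) * w (I t) * y (I s)
        = (∏ k ∈ univ.erase t, y (I k)) * w (I t) := by
    intro s t hst
    rw [erase_right_comm, ← prod_erase_mul (univ.erase t) (fun k => y (I k)) (a := s)
      (by simpa [ne_comm] using hst)]
    ring
  simp only [sum_mul]
  rw [sum_congr rfl fun s _ => sum_congr rfl fun t ht => h s t ht,
    sum_comm' (t' := univ) (s' := fun t => univ.erase t) (by simp [ne_comm])]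
  simp only [sum_const, card_erase_of_mem (mem_univ _), card_univ, Fintype.card_fin, nsmul_eq_mul]
  rw [← mul_sum]
  rcases m with _ | m
  · simp
  · push_cast
    simp only [add_tsub_cancel_right]
    ring

theorem formDeriv₂_self_right (c : (Fin m → Fin n) → ℝ) (y w : E n) :
    formDeriv₂ c y w y = ((m : ℝ) - 1) * formDeriv c y w := by
  rw [formDeriv₂_comm, formDeriv₂_self_left]

theorem form_smul (c : (Fin m → Fin n) → ℝ) (y : E n) (r : ℝ) :
    form c (r • y) = r ^ m * form c y := by
  simp only [form, PiLp.smul_apply, smul_eq_mul, prod_mul_distrib, prod_const, card_univ,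
    Fintype.card_fin, mul_sum]
  exact sum_congr rfl fun I _ => by ring

theorem formDeriv_smul_left (c : (Fin m → Fin n) → ℝ) (y w : E n) (r : ℝ) :
    formDeriv c (r • y) w = r ^ (m - 1) * formDeriv c y w := by
  simp only [formDeriv, PiLp.smul_apply, smul_eq_mul, prod_mul_distrib, prod_const,
    card_erase_of_mem (mem_univ _), card_univ, Fintype.card_fin, mul_sum]
  exact sum_congr rfl fun I _ => sum_congr rfl fun s _ => by ring

theorem form_smul_left (c : (Fin m → Fin n) → ℝ) (y : E n) (r : ℝ) :
    form (r • c) y = r * form c y := by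
  simp only [form, Pi.smul_apply, smul_eq_mul, mul_sum, mul_assoc]

theorem formDeriv_smul_coeff (c : (Fin m → Fin n) → ℝ) (y w : E n) (r : ℝ) :
    formDeriv (r • c) y w = r * formDeriv c y w := by
  simp only [formDeriv, Pi.smul_apply, smul_eq_mul, mul_sum, mul_assoc]

/-- The value at `y` of a form whose coefficients are polynomials in `y` is polynomial in `y`. -/
theorem exists_eval_eq_form (C : (Fin m → Fin n) → MvPolynomial (Fin n) ℝ) :
    ∃ p : MvPolynomial (Fin n) ℝ, ∀ y : E n, MvPolynomial.eval y.ofLp p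
      = form (fun I => MvPolynomial.eval y.ofLp (C I)) y :=
  ⟨∑ I : Fin m → Fin n, C I * ∏ k, MvPolynomial.X (I k), fun y => by simp [form]⟩

theorem exists_eval_eq_formDeriv (C : (Fin m → Fin n) → MvPolynomial (Fin n) ℝ) (w : E n) :
    ∃ p : MvPolynomial (Fin n) ℝ, ∀ y : E n, MvPolynomial.eval y.ofLp p
      = formDeriv (fun I => MvPolynomial.eval y.ofLp (C I)) y w :=
  ⟨∑ I : Fin m → Fin n, C I *
      ∑ s, (∏ k ∈ univ.erase s, MvPolynomial.X (I k)) * MvPolynomial.C (w (I s)), fun y => by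
    simp [formDeriv]⟩

/-- Substituting one index: reading off the index in the place `s` and replacing it by `p` is the
same as summing over the arrays with `p` in the place `s` and over a further free index. -/
theorem sum_update_mul_prod (s : Fin m) (p : Fin n) (h : (Fin m → Fin n) → Fin n → ℝ) (y : E n) :
    ∑ J : Fin m → Fin n, h (Function.update J s p) (J s) * ∏ k, y (J k)
      = ∑ I : Fin m → Fin n,
          (∏ k ∈ univ.erase s, y (I k)) * (EuclideanSpace.single p (1 : ℝ) : E n) (I s) *
            ∑ k, h I k * y k := by
  have e : ∀ I : Fin m → Fin n,
      (∏ k ∈ univ.erase s, y (I k)) * (EuclideanSpace.single p (1 : ℝ) : E n) (I s) *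
            ∑ k, h I k * y k
        = ∑ k, if I s = p then h I k * (y k * ∏ k ∈ univ.erase s, y (I k)) else 0 := by
    intro I
    by_cases hI : I s = p
    · simp only [hI, if_true, PiLp.single_apply, mul_one, mul_sum]
      exact sum_congr rfl fun k _ => by ring
    · simp [hI]
  rw [sum_congr rfl fun I _ => e I, ← sum_product', ← sum_filter]
  refine sum_bij' (fun J _ => (Function.update J s p, J s))
    (fun q _ => Function.update q.1 s q.2) ?_ ?_ ?_ ?_ ?_
  · intro J _
    simp
  · intro q _
    simp
  · intro J _
    simp
  · rintro ⟨I, k⟩ hq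
    have hI : I s = p := by simpa using hq
    simp [← hI]
  · intro J _
    rw [← mul_prod_erase univ (fun k => y (J k)) (mem_univ s)]
    congr 2
    refine prod_congr rfl fun k hk => ?_
    simp [Function.update_of_ne (ne_of_mem_erase hk)]

/-! ### Polarization and the coefficient identity -/

/-- The multilinear form on `N` vectors with coefficient array `b`, which need not be symmetric;
`form b` is its restriction to the diagonal. -/
def multiForm {N : ℕ} (b : (Fin N → Fin n) → ℝ) : (E n) [×N]→L[ℝ] ℝ :=
  ∑ K : Fin N → Fin n, b K •
    (ContinuousMultilinearMap.mkPiAlgebra ℝ (Fin N) ℝ).compContinuousLinearMap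
      (fun k => (EuclideanSpace.proj (K k) : E n →L[ℝ] ℝ))

theorem multiForm_apply {N : ℕ} (b : (Fin N → Fin n) → ℝ) (v : Fin N → E n) :
    multiForm b v = ∑ K : Fin N → Fin n, b K * ∏ k, v k (K k) := by
  simp [multiForm]

theorem multiForm_single {N : ℕ} (b : (Fin N → Fin n) → ℝ) (L : Fin N → Fin n) :
    multiForm b (fun k => EuclideanSpace.single (L k) (1 : ℝ)) = b L := by
  rw [multiForm_apply, sum_eq_single L]
  · simp
  · intro K _ hK
    obtain ⟨k, hk⟩ := Function.ne_iff.1 hK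
    rw [prod_eq_zero (mem_univ k) (by simp [hk]), mul_zero]
  · simp

/-- Polarization: the symmetrization of a coefficient array over `Fin N` is zero if and only if the
polynomial function that it defines is zero. -/
theorem sum_perm_eq_zero_iff_fin {N : ℕ} (b : (Fin N → Fin n) → ℝ) :
    (∀ K : Fin N → Fin n, ∑ σ : Equiv.Perm (Fin N), b (fun k => K (σ k)) = 0) ↔
      ∀ y : E n, form b y = 0 := by
  constructor
  · intro h y
    have h1 : ∑ K : Fin N → Fin n, ∑ σ : Equiv.Perm (Fin N),
        b (fun k => K (σ k)) * ∏ k, y (K k) = 0 :=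
      sum_eq_zero fun K _ => by rw [← sum_mul, h K, zero_mul]
    have h2 : ∀ σ : Equiv.Perm (Fin N),
        ∑ K : Fin N → Fin n, b (fun k => K (σ k)) * ∏ k, y (K k) = form b y := by
      intro σ
      refine Fintype.sum_equiv (σ.symm.arrowCongr (Equiv.refl (Fin n))) _ _ fun K => ?_
      have : (∏ k, y (K (σ k))) = ∏ k, y (K k) := Equiv.prod_comp σ fun k => y (K k)
      rw [← this]
      rfl
    rw [sum_comm, sum_congr rfl fun σ _ => h2 σ, sum_const, nsmul_eq_mul] at h1
    refine (mul_eq_zero.1 h1).resolve_left ?_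
    simp [Fintype.card_ne_zero]
  · intro h K
    -- The `N`-th derivative of the polynomial, evaluated on basis vectors, is the symmetrization.
    have h0 : (fun y : E n => multiForm b fun _ => y) = fun _ => 0 := by
      funext y
      rw [multiForm_apply]
      exact h y
    have := (multiForm b).iteratedFDeriv_comp_diagonal 0
      (fun k => EuclideanSpace.single (K k) (1 : ℝ))
    rw [h0] at this
    rw [← sum_congr rfl fun σ _ => multiForm_single b (fun k => K (σ k)), ← this]
    rw [iteratedFDeriv_fun_zero]
    rfl

theorem sum_perm_eq_zero_iff {ι : Type*} [Fintype ι] [DecidableEq ι] (b : (ι → Fin n) → ℝ) :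
    (∀ K : ι → Fin n, ∑ σ : Equiv.Perm ι, b (fun k => K (σ k)) = 0) ↔
      ∀ y : E n, ∑ K : ι → Fin n, b K * ∏ k, y (K k) = 0 := by
  let e := Fintype.equivFin ι
  have h := sum_perm_eq_zero_iff_fin (fun K : Fin (Fintype.card ι) → Fin n => b fun k => K (e k))
  have h1 : ∀ y : E n, form (fun K : Fin (Fintype.card ι) → Fin n => b fun k => K (e k)) y
      = ∑ K : ι → Fin n, b K * ∏ k, y (K k) := by
    intro y
    refine Fintype.sum_equiv (e.symm.arrowCongr (Equiv.refl (Fin n))) _ _ fun K => ?_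
    have : (∏ k, y (K (e k))) = ∏ k, y (K k) := Equiv.prod_comp e fun k => y (K k)
    rw [← this]
    rfl
  simp only [h1] at h
  rw [← h]
  have h2 : ∀ K : Fin (Fintype.card ι) → Fin n,
      ∑ σ : Equiv.Perm ι, b (fun k => K (e (σ k)))
        = ∑ σ : Equiv.Perm (Fin (Fintype.card ι)), b (fun k => K (σ (e k))) := by
    intro K
    refine Fintype.sum_equiv e.permCongr _ _ fun σ => ?_
    simp
  constructor
  · intro H K
    rw [← h2]
    exact H fun k => K (e k)
  · intro H K
    have := H (fun k => K (e.symm k))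
    rw [← h2 fun k => K (e.symm k)] at this
    simpa using this

/-- The derivatives in the direction `v` of the coefficients `a` at the point `u`. -/
def coeffDeriv (a : (Fin m → Fin n) → E n → ℝ) (u v : E n) (I : Fin m → Fin n) : ℝ :=
  fderiv ℝ (a I) u v

theorem coeffDeriv_single (a : (Fin m → Fin n) → E n → ℝ) (u : E n) (i : Fin n)
    (I : Fin m → Fin n) :
    coeffDeriv a u (EuclideanSpace.single i 1) I = pd i (a I) u := rfl

theorem eq_sum_smul_single (w : E n) :
    w = ∑ k, w k • (EuclideanSpace.single k (1 : ℝ) : E n) := by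
  ext i
  simp [WithLp.ofLp_sum, Finset.sum_apply, Pi.single_apply]

theorem coeffDeriv_eq_sum (a : (Fin m → Fin n) → E n → ℝ) (u y : E n) (I : Fin m → Fin n) :
    coeffDeriv a u y I = ∑ k, pd k (a I) u * y k := by
  unfold coeffDeriv
  conv_lhs => rw [eq_sum_smul_single y]
  rw [map_sum]
  refine sum_congr rfl fun k _ => ?_
  rw [map_smul, smul_eq_mul, mul_comm]
  rfl

theorem form_coeffDeriv_eq_sum (a : (Fin m → Fin n) → E n → ℝ) (u v y : E n) :
    form (coeffDeriv a u v) y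
      = ∑ k, form (coeffDeriv a u (EuclideanSpace.single k 1)) y * v k := by
  simp only [form, sum_mul, coeffDeriv_eq_sum a u v, coeffDeriv_single]
  rw [sum_comm]
  exact sum_congr rfl fun i _ => sum_congr rfl fun I _ => by ring

/-- Contracting `γ_{p j₁…j_m}` with `y` gives
`(1/(m(m-1))) (yᵏ ∂²T/∂xᵏ∂yᵖ - ∂T/∂xᵖ)`. -/
theorem form_gamma (a : (Fin m → Fin n) → E n → ℝ) (p : Fin n) (u y : E n) :
    form (fun J => gamma a p J u) y = (1 / ((m : ℝ) * ((m : ℝ) - 1))) *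
      (formDeriv (coeffDeriv a u y) y (EuclideanSpace.single p 1) -
        form (coeffDeriv a u (EuclideanSpace.single p 1)) y) := by
  have h : ∑ J : Fin m → Fin n, ∑ s : Fin m,
      pd (J s) (a (Function.update J s p)) u * ∏ k, y (J k)
        = formDeriv (coeffDeriv a u y) y (EuclideanSpace.single p 1) := by
    rw [sum_comm, sum_congr rfl fun s _ =>
      sum_update_mul_prod s p (fun I k => pd k (a I) u) y, sum_comm]
    unfold formDeriv
    refine sum_congr rfl fun I _ => ?_
    rw [← sum_mul, ← coeffDeriv_eq_sum, mul_comm]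
  rw [← h]
  simp only [form, gamma, mul_sum, ← sum_sub_distrib, mul_sub, sum_mul, sub_mul, coeffDeriv_single]
  simp only [mul_assoc]

/-- For symmetric coefficients each of the `m` places contributes equally to the derivative of the
form. -/
theorem formDeriv_eq_mul_sum [NeZero m] {c : (Fin m → Fin n) → ℝ}
    (hc : ∀ (σ : Equiv.Perm (Fin m)) (I : Fin m → Fin n), c (fun k => I (σ k)) = c I)
    (y w : E n) :
    formDeriv c y w
      = m * ∑ I : Fin m → Fin n, c I * ((∏ k ∈ univ.erase 0, y (I k)) * w (I 0)) := by
  unfold formDeriv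
  simp only [mul_sum (s := (univ : Finset (Fin m)))]
  rw [sum_comm]
  have h : ∀ s : Fin m,
      ∑ I : Fin m → Fin n, c I * ((∏ k ∈ univ.erase s, y (I k)) * w (I s))
        = ∑ I : Fin m → Fin n, c I * ((∏ k ∈ univ.erase 0, y (I k)) * w (I 0)) := by
    intro s
    refine Fintype.sum_equiv ((Equiv.swap 0 s).arrowCongr (Equiv.refl (Fin n))) _ _ fun I => ?_
    have h1 : ((Equiv.swap 0 s).arrowCongr (Equiv.refl (Fin n))) I
        = fun k => I (Equiv.swap 0 s k) := by
      funext k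
      simp [Equiv.arrowCongr]
    rw [h1, hc]
    simp only [Equiv.swap_apply_left]
    congr 2
    refine prod_equiv (Equiv.swap 0 s) ?_ ?_
    · intro k
      simp [Equiv.swap_apply_eq_iff]
    · simp
  rw [sum_congr rfl fun s _ => h s]
  simp

/-- Contracting `a_{j i₂…i_m} ∂_{i₁} a_{j₁…j_m}` with `y` gives `(1/m) ∂T/∂yʲ · yᵏ ∂T/∂xᵏ`. -/
theorem sum_coeff_update_mul_pd [NeZero m] {a : (Fin m → Fin n) → E n → ℝ} {u : E n}
    (hsym : ∀ (σ : Equiv.Perm (Fin m)) (I : Fin m → Fin n), a (fun k => I (σ k)) u = a I u)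
    (j : Fin n) (y : E n) :
    m * ∑ I : Fin m → Fin n, ∑ J : Fin m → Fin n,
        a (Function.update I 0 j) u * pd (I 0) (a J) u * ((∏ k, y (I k)) * ∏ k, y (J k))
      = formDeriv (fun I => a I u) y (EuclideanSpace.single j 1) * form (coeffDeriv a u y) y := by
  have h2 : ∀ I : Fin m → Fin n, ∑ J : Fin m → Fin n,
      a (Function.update I 0 j) u * pd (I 0) (a J) u * ((∏ k, y (I k)) * ∏ k, y (J k))
        = (a (Function.update I 0 j) u *
            form (coeffDeriv a u (EuclideanSpace.single (I 0) 1)) y) * ∏ k, y (I k) := by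
    intro I
    simp only [form, sum_mul, mul_sum, coeffDeriv_single]
    exact sum_congr rfl fun J _ => by ring
  rw [sum_congr rfl fun I _ => h2 I, sum_update_mul_prod 0 j
    (fun I k => a I u * form (coeffDeriv a u (EuclideanSpace.single k 1)) y) y,
    formDeriv_eq_mul_sum hsym, mul_assoc, sum_mul]
  congr 1
  refine sum_congr rfl fun I _ => ?_
  rw [form_coeffDeriv_eq_sum a u y y]
  simp only [mul_assoc, ← mul_sum]
  ring

/-- Hamel's condition `yᵏ ∂²F/∂xᵏ∂yⁱ = ∂F/∂xⁱ` for `F = |T|^{1/m}`, multiplied out so that it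
becomes polynomial in `y`. -/
def HamelAt (a : (Fin m → Fin n) → E n → ℝ) (u y : E n) : Prop :=
  ∀ i : Fin n,
    m * form (fun I => a I u) y *
        (formDeriv (coeffDeriv a u y) y (EuclideanSpace.single i 1) -
          form (coeffDeriv a u (EuclideanSpace.single i 1)) y)
      = (m - 1) * formDeriv (fun I => a I u) y (EuclideanSpace.single i 1) *
          form (coeffDeriv a u y) y

/-- The symmetrized coefficient identity says that the polynomials in Hamel's condition agree. -/
theorem coefficientIdentity_iff [NeZero m] (hm : 2 ≤ m) {a : (Fin m → Fin n) → E n → ℝ}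
    {U : Set (E n)}
    (hsym : ∀ (σ : Equiv.Perm (Fin m)) (I : Fin m → Fin n) (u : E n),
      a (fun k => I (σ k)) u = a I u) :
    CoefficientIdentity a U ↔ ∀ u ∈ U, ∀ y, HamelAt a u y := by
  have hm1 : (m : ℝ) - 1 ≠ 0 := by
    have : (2 : ℝ) ≤ m := by exact_mod_cast hm
    linarith
  have hm0 : (m : ℝ) ≠ 0 := NeZero.ne _
  -- The difference of the two tensors whose symmetrizations are compared.
  let b : E n → Fin n → (Fin m ⊕ Fin m → Fin n) → ℝ := fun u j K =>
    m * (a (fun k => K (Sum.inl k)) u * gamma a j (fun k => K (Sum.inr k)) u) -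
      a (Function.update (fun k => K (Sum.inl k)) 0 j) u *
        pd (K (Sum.inl 0)) (a (fun k => K (Sum.inr k))) u
  have h1 : CoefficientIdentity a U ↔ ∀ u ∈ U, ∀ (j : Fin n) (K : Fin m ⊕ Fin m → Fin n),
      ∑ σ : Equiv.Perm (Fin m ⊕ Fin m), b u j (fun k => K (σ k)) = 0 := by
    unfold CoefficientIdentity
    refine forall₂_congr fun u _ => forall_congr' fun j => ?_
    simp only [b, sum_sub_distrib, ← mul_sum, sub_eq_zero]
    constructor
    · intro H K
      have := H (fun k => K (Sum.inl k)) (fun k => K (Sum.inr k))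
      rwa [show Sum.elim (fun k => K (Sum.inl k)) (fun k => K (Sum.inr k)) = K from
        Sum.elim_comp_inl_inr K] at this
    · intro H I J
      exact H (Sum.elim I J)
  have h2 : ∀ u j (y : E n), m * ∑ K, b u j K * ∏ k, y (K k)
      = m / (m - 1) * form (fun I => a I u) y *
        (formDeriv (coeffDeriv a u y) y (EuclideanSpace.single j 1) -
          form (coeffDeriv a u (EuclideanSpace.single j 1)) y) -
        formDeriv (fun I => a I u) y (EuclideanSpace.single j 1) * form (coeffDeriv a u y) y := by
    intro u j y
    rw [← sum_coeff_update_mul_pd (fun σ I => hsym σ I u)]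
    have h3 : ∑ K, b u j K * ∏ k, y (K k)
        = ∑ I : Fin m → Fin n, ∑ J : Fin m → Fin n,
          (m * ((a I u * ∏ k, y (I k)) * (gamma a j J u * ∏ k, y (J k))) -
            a (Function.update I 0 j) u * pd (I 0) (a J) u *
              ((∏ k, y (I k)) * ∏ k, y (J k))) := by
      rw [← Fintype.sum_prod_type']
      refine Fintype.sum_equiv (Equiv.sumArrowEquivProdArrow _ _ _) _ _ fun K => ?_
      rw [Fintype.prod_sum_type]
      simp only [b, Equiv.sumArrowEquivProdArrow, Equiv.coe_fn_mk, Function.comp_def]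
      ring
    rw [h3]
    simp only [sum_sub_distrib, ← mul_sum, ← sum_mul]
    rw [mul_sub]
    have := form_gamma a j u y
    unfold form at this ⊢
    rw [this]
    congr 1
    field_simp
  rw [h1]
  refine forall₂_congr fun u _ => ?_
  unfold HamelAt
  rw [forall_comm (α := E n)]
  refine forall_congr' fun j => ?_
  rw [sum_perm_eq_zero_iff]
  refine forall_congr' fun y => ?_
  rw [← mul_right_inj' hm0, h2, mul_zero, sub_eq_zero, ← mul_right_inj' hm1]
  constructor <;> intro H
  · rw [← mul_assoc, ← mul_assoc, mul_div_cancel₀ _ hm1] at H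
    linear_combination H
  · rw [← mul_assoc, ← mul_assoc, mul_div_cancel₀ _ hm1]
    linear_combination H

/-! ### Derivatives of the metric -/

theorem hasDerivAt_abs_rpow {r : ℝ} (hr : r ≠ 0) (q : ℝ) :
    HasDerivAt (fun r : ℝ => |r| ^ q) (q * |r| ^ q / r) r := by
  have h := (hasDerivAt_abs hr).rpow_const (p := q) (Or.inl (abs_ne_zero.2 hr))
  convert! h using 1
  rw [Real.rpow_sub_one (abs_ne_zero.2 hr)]
  rcases hr.lt_or_gt with h | h
  · simp [h, abs_of_neg h]
    field_simp
  · simp [h, abs_of_pos h]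
    field_simp

theorem hasDerivAt_abs_rpow_div {r : ℝ} (hr : r ≠ 0) (q : ℝ) :
    HasDerivAt (fun r : ℝ => q * |r| ^ q / r) (q * (q - 1) * |r| ^ q / r ^ 2) r := by
  have h := (((hasDerivAt_abs_rpow hr q).const_mul q).div (hasDerivAt_id r) hr)
  convert! h using 1
  simp only [id]
  field_simp

theorem pd_abs_rpow {h : E n → ℝ} {u : E n} (hh : DifferentiableAt ℝ h u) (h0 : h u ≠ 0) (q : ℝ)
    (i : Fin n) : pd i (fun u => |h u| ^ q) u = q * |h u| ^ q / h u * pd i h u := by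
  have := (hasDerivAt_abs_rpow h0 q).comp_hasFDerivAt u hh.hasFDerivAt
  unfold pd
  rw [show (fun u => |h u| ^ q) = (fun r : ℝ => |r| ^ q) ∘ h from rfl, this.fderiv]
  simp

theorem pd_abs_rpow_div_mul {h k : E n → ℝ} {u : E n} (hh : DifferentiableAt ℝ h u)
    (hk : DifferentiableAt ℝ k u) (h0 : h u ≠ 0) (q : ℝ) (i : Fin n) :
    pd i (fun u => q * |h u| ^ q / h u * k u) u
      = q * |h u| ^ q / h u ^ 2 * ((q - 1) * pd i h u * k u + h u * pd i k u) := by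
  have := ((hasDerivAt_abs_rpow_div h0 q).comp_hasFDerivAt u hh.hasFDerivAt).mul hk.hasFDerivAt
  unfold pd
  rw [show (fun u => q * |h u| ^ q / h u * k u) = ((fun r : ℝ => q * |r| ^ q / r) ∘ h) * k from rfl,
    this.fderiv]
  simp only [add_apply, smul_apply, smul_eq_mul,
    Function.comp_apply]
  field_simp
  ring

theorem pd_eq_of_hasDerivAt {f : E n → ℝ} {u : E n} {i : Fin n} {d : ℝ}
    (hf : DifferentiableAt ℝ f u)
    (h : HasDerivAt (fun s : ℝ => f (u + s • EuclideanSpace.single i 1)) d 0) :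
    pd i f u = d := by
  have h1 : HasDerivAt (fun s : ℝ => u + s • (EuclideanSpace.single i 1 : E n))
      (EuclideanSpace.single i 1) 0 := by
    simpa using ((hasDerivAt_id (0 : ℝ)).smul_const (EuclideanSpace.single i 1 : E n)).const_add u
  have h2 : HasFDerivAt f (fderiv ℝ f u) (u + (0 : ℝ) • (EuclideanSpace.single i 1 : E n)) := by
    simpa using hf.hasFDerivAt
  exact (h2.comp_hasDerivAt (0 : ℝ) h1).unique h

theorem hasDerivAt_line (u v : E n) : HasDerivAt (fun s : ℝ => u + s • v) v 0 := by
  simpa using ((hasDerivAt_id (0 : ℝ)).smul_const v).const_add u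

theorem differentiable_form (c : (Fin m → Fin n) → ℝ) : Differentiable ℝ (form c) := by
  unfold form
  fun_prop

theorem differentiable_formDeriv (c : (Fin m → Fin n) → ℝ) (w : E n) :
    Differentiable ℝ (fun y => formDeriv c y w) := by
  unfold formDeriv
  fun_prop

theorem form_zero_left (y : E n) : form (0 : (Fin m → Fin n) → ℝ) y = 0 := by simp [form]

theorem formDeriv_zero_left (y w : E n) : formDeriv (0 : (Fin m → Fin n) → ℝ) y w = 0 := by
  simp [formDeriv]

theorem formDeriv_zero_right (c : (Fin m → Fin n) → ℝ) (y : E n) : formDeriv c y 0 = 0 := by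
  simp [formDeriv]

theorem pd_form (c : (Fin m → Fin n) → ℝ) (y : E n) (i : Fin n) :
    pd i (form c) y = formDeriv c y (EuclideanSpace.single i 1) := by
  refine pd_eq_of_hasDerivAt (differentiable_form c y) ?_
  simpa [form_zero_left] using hasDerivAt_form (c := fun _ => c) (c' := 0)
    (fun I => hasDerivAt_const 0 (c I)) (hasDerivAt_line y (EuclideanSpace.single i 1))

theorem pd_formDeriv (c : (Fin m → Fin n) → ℝ) (y w : E n) (i : Fin n) :
    pd i (fun y => formDeriv c y w) y = formDeriv₂ c y w (EuclideanSpace.single i 1) := by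
  refine pd_eq_of_hasDerivAt (differentiable_formDeriv c w y) ?_
  simpa [formDeriv_zero_left] using hasDerivAt_formDeriv (c := fun _ => c) (c' := 0)
    (fun I => hasDerivAt_const 0 (c I)) (hasDerivAt_line y (EuclideanSpace.single i 1)) w

theorem differentiableAt_form_coeff {a : (Fin m → Fin n) → E n → ℝ} {u : E n}
    (ha : ∀ I, DifferentiableAt ℝ (a I) u) (y : E n) :
    DifferentiableAt ℝ (fun u => form (fun I => a I u) y) u := by
  unfold form
  fun_prop

theorem pd_form_coeff {a : (Fin m → Fin n) → E n → ℝ} {u : E n}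
    (ha : ∀ I, DifferentiableAt ℝ (a I) u) (y : E n) (i : Fin n) :
    pd i (fun u => form (fun I => a I u) y) u
      = form (coeffDeriv a u (EuclideanSpace.single i 1)) y := by
  refine pd_eq_of_hasDerivAt (differentiableAt_form_coeff ha y) ?_
  have h : ∀ I, HasDerivAt (fun s : ℝ => a I (u + s • (EuclideanSpace.single i 1 : E n)))
      (coeffDeriv a u (EuclideanSpace.single i 1) I) 0 := by
    intro I
    have h2 : HasFDerivAt (a I) (fderiv ℝ (a I) u)
        (u + (0 : ℝ) • (EuclideanSpace.single i 1 : E n)) := by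
      simpa using (ha I).hasFDerivAt
    exact h2.comp_hasDerivAt (0 : ℝ) (hasDerivAt_line u _)
  simpa [formDeriv_zero_right] using hasDerivAt_form h (hasDerivAt_const 0 y)

theorem F_sq (a : (Fin m → Fin n) → E n → ℝ) (u y : E n) :
    F a u y ^ 2 = |form (fun I => a I u) y| ^ (2 / (m : ℝ)) := by
  rw [F, ← Real.rpow_natCast, ← Real.rpow_mul (abs_nonneg _)]
  congr 1
  push_cast
  ring

/-- The metric tensor in terms of the form `T`:
`g_{ij} = (1/m) |T|^{2/m} T⁻² ((2/m - 1) T_i T_j + T T_{ij})` where `T ≠ 0`. -/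
theorem g_apply (a : (Fin m → Fin n) → E n → ℝ) {u y : E n} (hT : T a u y ≠ 0) (i j : Fin n) :
    g a u y i j = 1 / m * |T a u y| ^ (2 / (m : ℝ)) / T a u y ^ 2 *
      ((2 / m - 1) * formDeriv (fun I => a I u) y (EuclideanSpace.single i 1) *
          formDeriv (fun I => a I u) y (EuclideanSpace.single j 1) +
        T a u y * formDeriv₂ (fun I => a I u) y (EuclideanSpace.single j 1)
          (EuclideanSpace.single i 1)) := by
  set c : (Fin m → Fin n) → ℝ := fun I => a I u with hc
  have hTc : T a u = form c := rfl
  have h1 : (fun z => pd j (fun w => F a u w ^ 2) z) =ᶠ[nhds y]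
      fun z => 2 / (m : ℝ) * |form c z| ^ (2 / (m : ℝ)) / form c z *
        formDeriv c z (EuclideanSpace.single j 1) := by
    filter_upwards [(differentiable_form c).continuous.continuousAt.eventually_ne hT] with z hz
    simp only [F_sq]
    rw [pd_abs_rpow (differentiable_form c z) hz, pd_form]
  have h2 : pd i (fun z => pd j (fun w => F a u w ^ 2) z) y
      = pd i (fun z => 2 / (m : ℝ) * |form c z| ^ (2 / (m : ℝ)) / form c z *
          formDeriv c z (EuclideanSpace.single j 1)) y := by
    unfold pd
    rw [← h1.fderiv_eq]
    rfl
  rw [g, Matrix.of_apply, h2, pd_abs_rpow_div_mul (differentiable_form c y)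
    (differentiable_formDeriv c _ y) hT, pd_form, pd_formDeriv, hTc]
  ring

theorem formDeriv_eq_sum (c : (Fin m → Fin n) → ℝ) (y w : E n) :
    formDeriv c y w = ∑ i, w i * formDeriv c y (EuclideanSpace.single i 1) := by
  let L : E n →ₗ[ℝ] ℝ :=
    { toFun := formDeriv c y
      map_add' := formDeriv_add c y
      map_smul' := fun r w => formDeriv_smul c y w r }
  change L w = ∑ i, w i * L (EuclideanSpace.single i 1)
  conv_lhs => rw [eq_sum_smul_single w]
  simp

theorem formDeriv₂_eq_sum (c : (Fin m → Fin n) → ℝ) (y v w : E n) :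
    formDeriv₂ c y v w = ∑ i, w i * formDeriv₂ c y v (EuclideanSpace.single i 1) := by
  let L : E n →ₗ[ℝ] ℝ :=
    { toFun := formDeriv₂ c y v
      map_add' := formDeriv₂_add c y v
      map_smul' := fun r w => formDeriv₂_smul c y v w r }
  change L w = ∑ i, w i * L (EuclideanSpace.single i 1)
  conv_lhs => rw [eq_sum_smul_single w]
  simp

/-- Where `T ≠ 0`, a kernel vector of the Hessian of `T` in `y` is a kernel vector of `g`: by
Euler's identity it is annihilated by the first derivative of `T`. -/
theorem eq_zero_of_formDeriv₂_eq_zero (hm : 2 ≤ m) {a : (Fin m → Fin n) → E n → ℝ} {u y : E n}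
    (hT : T a u y ≠ 0) (hg : (g a u y).det ≠ 0) {v : E n}
    (hv : ∀ i, formDeriv₂ (fun I => a I u) y (EuclideanSpace.single i 1) v = 0) : v = 0 := by
  set c : (Fin m → Fin n) → ℝ := fun I => a I u with hc
  have hm1 : (m : ℝ) - 1 ≠ 0 := by
    have : (2 : ℝ) ≤ m := by exact_mod_cast hm
    linarith
  have h1 : formDeriv c y v = 0 := by
    have h2 : formDeriv₂ c y v y = 0 := by
      rw [formDeriv₂_eq_sum]
      exact sum_eq_zero fun i _ => by rw [formDeriv₂_comm, hv i, mul_zero]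
    rw [formDeriv₂_self_right] at h2
    exact (mul_eq_zero.1 h2).resolve_left hm1
  by_contra hne
  refine hg (Matrix.exists_mulVec_eq_zero_iff.1 ⟨v.ofLp, ?_, ?_⟩)
  · intro h
    exact hne (by ext i; simpa using congrFun h i)
  · funext i
    have h3 := formDeriv_eq_sum c y v
    have h4 := formDeriv₂_eq_sum c y (EuclideanSpace.single i 1) v
    rw [h1] at h3
    rw [hv] at h4
    simp only [Matrix.mulVec, dotProduct, g_apply a hT, Pi.zero_apply]
    rw [← hc]
    have h5 : ∀ j, 1 / (m : ℝ) * |T a u y| ^ (2 / (m : ℝ)) / T a u y ^ 2 *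
        ((2 / m - 1) * formDeriv c y (EuclideanSpace.single i 1) *
          formDeriv c y (EuclideanSpace.single j 1) +
        T a u y * formDeriv₂ c y (EuclideanSpace.single j 1) (EuclideanSpace.single i 1)) * v j
        = 1 / (m : ℝ) * |T a u y| ^ (2 / (m : ℝ)) / T a u y ^ 2 *
          ((2 / m - 1) * formDeriv c y (EuclideanSpace.single i 1) *
              (v j * formDeriv c y (EuclideanSpace.single j 1)) +
            T a u y *
              (v j * formDeriv₂ c y (EuclideanSpace.single i 1) (EuclideanSpace.single j 1))) := by
      intro j
      rw [formDeriv₂_comm c y (EuclideanSpace.single j 1)]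
      ring
    rw [sum_congr rfl fun j _ => h5 j, ← mul_sum, sum_add_distrib, ← mul_sum, ← mul_sum, ← h3, ← h4]
    simp

/-! ### The geodesic equation -/

/-- The equation of the extremals of `T`,
`∂²T/∂yⁱ∂yᵏ zᵏ + yᵏ ∂²T/∂xᵏ∂yⁱ = ∂T/∂xⁱ`, for a curve with position `u`, velocity `y` and
acceleration `z`. -/
def GeodesicEqAt (a : (Fin m → Fin n) → E n → ℝ) (u y z : E n) : Prop :=
  ∀ i : Fin n,
    formDeriv (coeffDeriv a u y) y (EuclideanSpace.single i 1) +
        formDeriv₂ (fun I => a I u) y (EuclideanSpace.single i 1) z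
      = form (coeffDeriv a u (EuclideanSpace.single i 1)) y

theorem abs_T_eq_one_iff_F_eq_one [NeZero m] (a : (Fin m → Fin n) → E n → ℝ) (u y : E n) :
    |T a u y| = 1 ↔ F a u y = 1 := by
  have hm0 : (m : ℝ) ≠ 0 := NeZero.ne _
  constructor
  · intro h
    rw [F, h, Real.one_rpow]
  · intro h
    have := congrArg (· ^ (m : ℝ)) h
    simpa [F, ← Real.rpow_mul (abs_nonneg _), hm0] using this

theorem inv_eq_self_of_abs_eq_one {r : ℝ} (h : |r| = 1) : r⁻¹ = r := by
  rcases (abs_eq zero_le_one).1 h with rfl | rfl <;> norm_num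

theorem pd_F_velocity (a : (Fin m → Fin n) → E n → ℝ) {u y : E n} (hT : |T a u y| = 1)
    (i : Fin n) : pd i (fun y => F a u y) y
      = 1 / m * (form (fun I => a I u) y *
          formDeriv (fun I => a I u) y (EuclideanSpace.single i 1)) := by
  have h0 : form (fun I => a I u) y ≠ 0 := by
    intro h
    have : T a u y = 0 := h
    simp [this] at hT
  have hT' : |form (fun I => a I u) y| = 1 := hT
  change pd i (fun y => |form (fun I => a I u) y| ^ (1 / (m : ℝ))) y = _
  rw [pd_abs_rpow (differentiable_form _ y) h0, pd_form, hT', Real.one_rpow, div_eq_mul_inv,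
    inv_eq_self_of_abs_eq_one hT']
  ring

theorem pd_F_position {a : (Fin m → Fin n) → E n → ℝ} {u y : E n}
    (ha : ∀ I, DifferentiableAt ℝ (a I) u) (hT : |T a u y| = 1)
    (i : Fin n) : pd i (fun u => F a u y) u
      = 1 / m * (form (fun I => a I u) y *
          form (coeffDeriv a u (EuclideanSpace.single i 1)) y) := by
  have h0 : form (fun I => a I u) y ≠ 0 := by
    intro h
    have : T a u y = 0 := h
    simp [this] at hT
  have hT' : |form (fun I => a I u) y| = 1 := hT
  change pd i (fun u => |form (fun I => a I u) y| ^ (1 / (m : ℝ))) u = _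
  rw [pd_abs_rpow (differentiableAt_form_coeff ha y) h0, pd_form_coeff ha, hT', Real.one_rpow,
    div_eq_mul_inv, inv_eq_self_of_abs_eq_one hT']
  ring

theorem hasDerivAt_coeff_comp {a : (Fin m → Fin n) → E n → ℝ} {x : ℝ → E n} {x' : E n} {t : ℝ}
    (ha : ∀ I, DifferentiableAt ℝ (a I) (x t)) (hx : HasDerivAt x x' t) (I : Fin m → Fin n) :
    HasDerivAt (fun s => a I (x s)) (coeffDeriv a (x t) x' I) t :=
  (ha I).hasFDerivAt.comp_hasDerivAt t hx

/-- Along a curve of unit speed, the Euler-Lagrange equations for `F` at a time `t` say that `T`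
satisfies the geodesic equation. As `T = ±1` along the curve, the factor `T⁻¹ |T|^{1/m}` in the
derivatives of `F` is constant. -/
theorem eulerLagrange_iff [NeZero m] {a : (Fin m → Fin n) → E n → ℝ} {J : Set ℝ} (hJ : IsOpen J)
    {x : ℝ → E n} {t : ℝ} (ht : t ∈ J) {z : E n}
    (ha : ∀ I, DifferentiableAt ℝ (a I) (x t)) (hx : HasDerivAt x (deriv x t) t)
    (hx' : HasDerivAt (deriv x) z t) (hT : ∀ s ∈ J, |T a (x s) (deriv x s)| = 1) :
    (∀ i : Fin n, HasDerivAt (fun s => pd i (fun y => F a (x s) y) (deriv x s))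
      (pd i (fun u => F a u (deriv x t)) (x t)) t) ↔ GeodesicEqAt a (x t) (deriv x t) z := by
  have hm0 : (m : ℝ) ≠ 0 := NeZero.ne _
  have hJt : J ∈ nhds t := hJ.mem_nhds ht
  have hT0 : form (fun I => a I (x t)) (deriv x t) ≠ 0 := by
    intro h
    have h1 : T a (x t) (deriv x t) = 0 := h
    have := hT t ht
    simp [h1] at this
  have hc := hasDerivAt_coeff_comp ha hx
  have hTd := hasDerivAt_form hc hx'
  -- `T` is stationary along the curve, since `T² = 1` on `J`.
  have hzero : form (coeffDeriv a (x t) (deriv x t)) (deriv x t) +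
      formDeriv (fun I => a I (x t)) (deriv x t) z = 0 := by
    have h1 : (fun s => form (fun I => a I (x s)) (deriv x s) *
        form (fun I => a I (x s)) (deriv x s)) =ᶠ[nhds t] fun _ => (1 : ℝ) := by
      filter_upwards [hJt] with s hs
      have h2 : |form (fun I => a I (x s)) (deriv x s)| = 1 := hT s hs
      rw [← abs_mul_abs_self, h2, one_mul]
    have h3 := (hTd.mul hTd).unique ((hasDerivAt_const t (1 : ℝ)).congr_of_eventuallyEq h1)
    have h4 : 2 * form (fun I => a I (x t)) (deriv x t) ≠ 0 := mul_ne_zero two_ne_zero hT0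
    refine (mul_eq_zero.1 (?_ : (2 * form (fun I => a I (x t)) (deriv x t)) * _ = 0)).resolve_left h4
    linear_combination h3
  have key : ∀ i : Fin n, HasDerivAt (fun s => pd i (fun y => F a (x s) y) (deriv x s))
      (1 / m * (form (fun I => a I (x t)) (deriv x t) *
        (formDeriv (coeffDeriv a (x t) (deriv x t)) (deriv x t) (EuclideanSpace.single i 1) +
          formDeriv₂ (fun I => a I (x t)) (deriv x t) (EuclideanSpace.single i 1) z))) t := by
    intro i
    have h1 : (fun s => pd i (fun y => F a (x s) y) (deriv x s)) =ᶠ[nhds t]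
        fun s => 1 / m * (form (fun I => a I (x s)) (deriv x s) *
          formDeriv (fun I => a I (x s)) (deriv x s) (EuclideanSpace.single i 1)) := by
      filter_upwards [hJt] with s hs
      exact pd_F_velocity a (hT s hs) i
    have h2 := ((hTd.mul (hasDerivAt_formDeriv hc hx'
      (EuclideanSpace.single i 1))).const_mul (1 / (m : ℝ))).congr_of_eventuallyEq h1
    rwa [hzero, zero_mul, zero_add] at h2
  have h0 : (1 / (m : ℝ)) ≠ 0 := one_div_ne_zero hm0
  unfold GeodesicEqAt
  refine forall_congr' fun i => ?_
  rw [pd_F_position ha (hT t ht)]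
  constructor
  · intro h
    have := (key i).unique h
    exact mul_left_cancel₀ hT0 (mul_left_cancel₀ h0 this)
  · intro h
    rw [← h]
    exact key i

/-! ### Straight lines -/

theorem exists_antiderivative {J : Set ℝ} (hJ : IsOpen J) (hJc : J.OrdConnected) {c : ℝ → ℝ}
    (hc : ContinuousOn c J) : ∃ C : ℝ → ℝ, ∀ t ∈ J, HasDerivAt C (c t) t := by
  rcases J.eq_empty_or_nonempty with rfl | ⟨t₀, ht₀⟩
  · exact ⟨0, by simp⟩
  · refine ⟨fun t => ∫ s in t₀..t, c s, fun t ht => ?_⟩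
    refine intervalIntegral.integral_hasDerivAt_right ?_ ?_ (hc.continuousAt (hJ.mem_nhds ht))
    · exact (hc.mono (hJc.uIcc_subset ht₀ ht)).intervalIntegrable
    · exact hc.stronglyMeasurableAtFilter hJ t ht

theorem is_const_of_hasDerivAt_zero {X : Type*} [NormedAddCommGroup X] [NormedSpace ℝ X]
    {J : Set ℝ} (hJ : IsOpen J) (hJc : J.OrdConnected) {f : ℝ → X}
    (hf : ∀ t ∈ J, HasDerivAt f 0 t) {s t : ℝ} (hs : s ∈ J) (ht : t ∈ J) : f s = f t :=
  hJ.is_const_of_deriv_eq_zero hJc.isPreconnected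
    (fun t ht => (hf t ht).differentiableAt.differentiableWithinAt) (fun t ht => (hf t ht).deriv)
    hs ht

/-- A curve whose acceleration is everywhere proportional to its velocity `y ≠ 0` runs in a straight
line. -/
theorem collinear_of_acceleration {J : Set ℝ} (hJ : IsOpen J) (hJc : J.OrdConnected)
    {x y z : ℝ → E n} (hx : ∀ t ∈ J, HasDerivAt x (y t) t) (hy : ∀ t ∈ J, HasDerivAt y (z t) t)
    (hz : ContinuousOn z J) (hy0 : ∀ t ∈ J, y t ≠ 0) (hzy : ∀ t ∈ J, ∃ r : ℝ, z t = r • y t) :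
    Collinear ℝ (x '' J) := by
  rcases J.eq_empty_or_nonempty with rfl | ⟨t₀, ht₀⟩
  · simp [collinear_empty]
  have hyc : ContinuousOn y J := fun t ht => (hy t ht).continuousAt.continuousWithinAt
  let c : ℝ → ℝ := fun t => inner ℝ (y t) (z t) / inner ℝ (y t) (y t)
  have hyy : ∀ t ∈ J, inner ℝ (y t) (y t) ≠ 0 := fun t ht => inner_self_ne_zero.2 (hy0 t ht)
  have hc : ContinuousOn c J := (hyc.inner hz).div (hyc.inner hyc) hyy
  have hcz : ∀ t ∈ J, z t = c t • y t := by
    intro t ht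
    obtain ⟨r, hr⟩ := hzy t ht
    have : c t = r := by
      simp only [c, hr, inner_smul_right]
      exact mul_div_cancel_right₀ r (hyy t ht)
    rw [this, hr]
  obtain ⟨C, hC⟩ := exists_antiderivative hJ hJc hc
  have hD0 : ContinuousOn (fun t => Real.exp (C t)) J := fun t ht =>
    ((hC t ht).continuousAt.rexp).continuousWithinAt
  obtain ⟨D, hD⟩ := exists_antiderivative hJ hJc hD0
  -- `exp (-C) y` is constant, so that the direction of `y` is.
  have h1 : ∀ t ∈ J, Real.exp (-C t) • y t = Real.exp (-C t₀) • y t₀ := by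
    intro t ht
    refine is_const_of_hasDerivAt_zero hJ hJc (f := fun t => Real.exp (-C t) • y t) ?_ ht ht₀
    intro s hs
    have := ((hC s hs).neg.exp).smul (hy s hs)
    convert! this using 1
    rw [hcz s hs, smul_smul, ← add_smul]
    simp
  set v := Real.exp (-C t₀) • y t₀ with hv
  have h2 : ∀ t ∈ J, y t = Real.exp (C t) • v := by
    intro t ht
    rw [← h1 t ht, smul_smul, ← Real.exp_add]
    simp
  have h3 : ∀ t ∈ J, x t - D t • v = x t₀ - D t₀ • v := by
    intro t ht
    refine is_const_of_hasDerivAt_zero hJ hJc (f := fun t => x t - D t • v) ?_ ht ht₀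
    intro s hs
    have := (hx s hs).sub ((hD s hs).smul_const v)
    rwa [← h2 s hs, sub_self] at this
  rw [collinear_iff_exists_forall_eq_smul_vadd]
  refine ⟨x t₀ - D t₀ • v, v, ?_⟩
  rintro _ ⟨t, ht, rfl⟩
  exact ⟨D t, by rw [← h3 t ht, vadd_eq_add]; abel⟩

theorem mem_submodule_of_hasDerivAt {S : Submodule ℝ (E n)} {f : ℝ → E n} {f' : E n} {t : ℝ}
    (hf : HasDerivAt f f' t) (hS : ∀ᶠ s in nhds t, f s ∈ S) : f' ∈ S := by
  refine S.closed_of_finiteDimensional.mem_of_tendsto (hasDerivAt_iff_tendsto_slope.1 hf) ?_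
  filter_upwards [nhdsWithin_le_nhds hS] with s hs
  exact S.smul_mem _ (S.sub_mem hs hS.self_of_nhds)

/-- A curve in a straight line has its acceleration proportional to its velocity. -/
theorem exists_smul_of_collinear {J : Set ℝ} (hJ : IsOpen J)
    {x y z : ℝ → E n} (hx : ∀ t ∈ J, HasDerivAt x (y t) t) (hy : ∀ t ∈ J, HasDerivAt y (z t) t)
    (hcol : Collinear ℝ (x '' J)) {t : ℝ} (ht : t ∈ J) (hy0 : y t ≠ 0) :
    ∃ r : ℝ, z t = r • y t := by
  obtain ⟨v, hv⟩ := (collinear_iff_of_mem (Set.mem_image_of_mem x ht)).1 hcol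
  have h1 : ∀ s ∈ J, x s - x t ∈ Submodule.span ℝ {v} := by
    intro s hs
    obtain ⟨r, hr⟩ := hv _ (Set.mem_image_of_mem x hs)
    rw [Submodule.mem_span_singleton]
    exact ⟨r, by rw [hr, vadd_eq_add]; abel⟩
  have h2 : ∀ s ∈ J, y s ∈ Submodule.span ℝ {v} := fun s hs =>
    mem_submodule_of_hasDerivAt ((hx s hs).sub_const (x t))
      (by filter_upwards [hJ.mem_nhds hs] with s hs using h1 s hs)
  have h3 : z t ∈ Submodule.span ℝ {v} :=
    mem_submodule_of_hasDerivAt (hy t ht)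
      (by filter_upwards [hJ.mem_nhds ht] with s hs using h2 s hs)
  obtain ⟨p, hp⟩ := Submodule.mem_span_singleton.1 (h2 t ht)
  obtain ⟨q, hq⟩ := Submodule.mem_span_singleton.1 h3
  have hp0 : p ≠ 0 := by
    rintro rfl
    exact hy0 (by rw [← hp, zero_smul])
  exact ⟨q / p, by rw [← hp, ← hq, smul_smul, div_mul_cancel₀ _ hp0]⟩

/-! ### Hamel's condition and the acceleration of geodesics -/

theorem ne_zero_of_T_ne_zero [NeZero m] {a : (Fin m → Fin n) → E n → ℝ} {u y : E n}
    (hT : T a u y ≠ 0) : y ≠ 0 := by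
  rintro rfl
  refine hT (sum_eq_zero fun I _ => ?_)
  rw [prod_eq_zero (mem_univ (0 : Fin m)) (by simp), mul_zero]

/-- `T` is constant along the solutions of the geodesic equation: contract the equation with the
velocity and use Euler's identities. -/
theorem GeodesicEqAt.form_add_formDeriv (hm : 2 ≤ m) {a : (Fin m → Fin n) → E n → ℝ} {u y z : E n}
    (h : GeodesicEqAt a u y z) :
    form (coeffDeriv a u y) y + formDeriv (fun I => a I u) y z = 0 := by
  have hm1 : (m : ℝ) - 1 ≠ 0 := by
    have : (2 : ℝ) ≤ m := by exact_mod_cast hm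
    linarith
  have h1 := formDeriv_eq_sum (coeffDeriv a u y) y y
  have h2 := formDeriv₂_eq_sum (fun I => a I u) y z y
  have h3 := form_coeffDeriv_eq_sum a u y y
  have h4 : formDeriv (coeffDeriv a u y) y y + formDeriv₂ (fun I => a I u) y z y
      = form (coeffDeriv a u y) y := by
    rw [h1, h2, h3, ← sum_add_distrib]
    refine sum_congr rfl fun i _ => ?_
    rw [← h i, formDeriv₂_comm _ y z]
    ring
  rw [formDeriv_self, formDeriv₂_self_right] at h4
  refine (mul_eq_zero.1 (?_ : ((m : ℝ) - 1) * _ = 0)).resolve_left hm1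
  linear_combination h4

/-- If a geodesic has its acceleration proportional to its velocity at a time, then Hamel's
condition holds there. -/
theorem GeodesicEqAt.hamelAt (hm : 2 ≤ m) {a : (Fin m → Fin n) → E n → ℝ} {u y : E n} {r : ℝ}
    (h : GeodesicEqAt a u y (r • y)) : HamelAt a u y := by
  have h1 := h.form_add_formDeriv hm
  rw [formDeriv_smul, formDeriv_self] at h1
  intro i
  have h2 := h i
  rw [formDeriv₂_smul, formDeriv₂_self_right] at h2
  rw [← h2]
  linear_combination (-(m - 1) * formDeriv (fun I => a I u) y (EuclideanSpace.single i 1)) * h1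

/-- Hamel's condition forces the acceleration of a geodesic to be proportional to its velocity. -/
theorem HamelAt.exists_eq_smul (hm : 2 ≤ m) {a : (Fin m → Fin n) → E n → ℝ} {u y z : E n}
    (hH : HamelAt a u y) (hT : T a u y ≠ 0) (hg : (g a u y).det ≠ 0)
    (hz : GeodesicEqAt a u y z) : ∃ r : ℝ, z = r • y := by
  have hT0 : form (fun I => a I u) y ≠ 0 := hT
  have hm0 : (m : ℝ) ≠ 0 := by
    have : (2 : ℝ) ≤ m := by exact_mod_cast hm
    linarith
  -- The factor `-T_0 / (m T)` is found by contracting the geodesic equation with `y`.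
  refine ⟨-(form (coeffDeriv a u y) y / (m * form (fun I => a I u) y)), ?_⟩
  rw [← sub_eq_zero, neg_smul, sub_neg_eq_add]
  refine eq_zero_of_formDeriv₂_eq_zero hm hT hg fun i => ?_
  rw [formDeriv₂_add, formDeriv₂_smul, formDeriv₂_self_right]
  have h1 := hH i
  have h2 := hz i
  rw [← h2] at h1
  field_simp
  linear_combination -h1

/-- If Hamel's condition holds on an open set, then the geodesics in it are straight. -/
theorem geodesicsStraight_of_hamelAt [NeZero m] (hm : 2 ≤ m) {a : (Fin m → Fin n) → E n → ℝ}
    {U : Set (E n)} (hU : IsOpen U) (ha : ∀ I, ContDiffOn ℝ ∞ (a I) U)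
    (hg : ∀ u ∈ U, ∀ y, T a u y ≠ 0 → (g a u y).det ≠ 0)
    (hH : ∀ u ∈ U, ∀ y, HamelAt a u y) : GeodesicsStraight a U := by
  intro J x hJ hJc hx
  obtain ⟨hdx, -, hx1⟩ := (contDiffOn_succ_iff_deriv_of_isOpen (n := 1) hJ).1 hx.contDiffOn
  obtain ⟨hdx', -, hx2⟩ := (contDiffOn_succ_iff_deriv_of_isOpen (n := 0) hJ).1 hx1
  have h1 : ∀ t ∈ J, HasDerivAt x (deriv x t) t := fun t ht =>
    (hdx.differentiableAt (hJ.mem_nhds ht)).hasDerivAt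
  have h2 : ∀ t ∈ J, HasDerivAt (deriv x) (deriv (deriv x) t) t := fun t ht =>
    (hdx'.differentiableAt (hJ.mem_nhds ht)).hasDerivAt
  have hT : ∀ t ∈ J, |T a (x t) (deriv x t)| = 1 := fun t ht =>
    (abs_T_eq_one_iff_F_eq_one a _ _).2 (hx.unitSpeed t ht)
  have hT0 : ∀ t ∈ J, T a (x t) (deriv x t) ≠ 0 := fun t ht => by
    rw [← abs_pos, hT t ht]
    exact one_pos
  refine collinear_of_acceleration hJ hJc h1 h2 hx2.continuousOn
    (fun t ht => ne_zero_of_T_ne_zero (hT0 t ht)) fun t ht => ?_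
  have hxt := hx.mapsTo ht
  refine (hH _ hxt _).exists_eq_smul hm (hT0 t ht) (hg _ hxt _ (hT0 t ht)) ?_
  exact (eulerLagrange_iff hJ ht (fun I => ((ha I).differentiableOn (by simp)).differentiableAt
    (hU.mem_nhds hxt)) (h1 t ht) (h2 t ht) hT).1 (hx.eulerLagrange t ht)

/-! ### Existence of geodesics -/

/-- The Hessian of `T` in `y`. -/
def hessian (a : (Fin m → Fin n) → E n → ℝ) (u y : E n) : Matrix (Fin n) (Fin n) ℝ :=
  Matrix.of fun i j => formDeriv₂ (fun I => a I u) y (EuclideanSpace.single i 1)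
    (EuclideanSpace.single j 1)

/-- The inhomogeneous part `∂T/∂xⁱ - yᵏ ∂²T/∂xᵏ∂yⁱ` of the geodesic equation. -/
def force (a : (Fin m → Fin n) → E n → ℝ) (u y : E n) (i : Fin n) : ℝ :=
  form (coeffDeriv a u (EuclideanSpace.single i 1)) y -
    formDeriv (coeffDeriv a u y) y (EuclideanSpace.single i 1)

/-- The acceleration of the geodesic with position `u` and velocity `y`, from Cramer's rule; it is
meaningful where the Hessian of `T` in `y` is nondegenerate. -/
def acceleration (a : (Fin m → Fin n) → E n → ℝ) (u y : E n) : E n :=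
  WithLp.toLp 2 fun i => (hessian a u y).cramer (force a u y) i / (hessian a u y).det

theorem hessian_mulVec (a : (Fin m → Fin n) → E n → ℝ) (u y z : E n) (i : Fin n) :
    (hessian a u y).mulVec z.ofLp i
      = formDeriv₂ (fun I => a I u) y (EuclideanSpace.single i 1) z := by
  rw [formDeriv₂_eq_sum]
  simp only [Matrix.mulVec, dotProduct, hessian, Matrix.of_apply]
  exact sum_congr rfl fun j _ => mul_comm _ _

theorem hessian_det_ne_zero (hm : 2 ≤ m) {a : (Fin m → Fin n) → E n → ℝ} {u y : E n}
    (hT : T a u y ≠ 0) (hg : (g a u y).det ≠ 0) : (hessian a u y).det ≠ 0 := by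
  intro h
  obtain ⟨v, hv0, hv⟩ := Matrix.exists_mulVec_eq_zero_iff.2 h
  refine hv0 (congrArg WithLp.ofLp
    (eq_zero_of_formDeriv₂_eq_zero hm hT hg (v := WithLp.toLp 2 v) fun i => ?_))
  rw [← hessian_mulVec]
  exact congrFun hv i

theorem geodesicEqAt_acceleration {a : (Fin m → Fin n) → E n → ℝ} {u y : E n}
    (h : (hessian a u y).det ≠ 0) : GeodesicEqAt a u y (acceleration a u y) := by
  intro i
  have h1 : (acceleration a u y).ofLp
      = (hessian a u y).det⁻¹ • (hessian a u y).cramer (force a u y) := by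
    funext i
    simp [acceleration, div_eq_inv_mul]
  rw [← hessian_mulVec, h1, Matrix.mulVec_smul, Matrix.mulVec_cramer, smul_smul,
    inv_mul_cancel₀ h, one_smul, force]
  ring

theorem contDiffAt_det {X : Type*} [NormedAddCommGroup X] [NormedSpace ℝ X]
    {A : X → Matrix (Fin n) (Fin n) ℝ} {p : X} {N : WithTop ℕ∞}
    (h : ∀ i j, ContDiffAt ℝ N (fun p => A p i j) p) : ContDiffAt ℝ N (fun p => (A p).det) p := by
  simp only [Matrix.det_apply]
  refine ContDiffAt.sum fun σ _ => ContDiffAt.const_smul _ ?_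
  exact contDiffAt_prod fun i _ => h _ _

theorem contDiffAt_acceleration {a : (Fin m → Fin n) → E n → ℝ} {U : Set (E n)} (hU : IsOpen U)
    (ha : ∀ I, ContDiffOn ℝ ∞ (a I) U) {u y : E n} (hu : u ∈ U) (h : (hessian a u y).det ≠ 0) :
    ContDiffAt ℝ 1 (fun p : E n × E n => acceleration a p.1 p.2) (u, y) := by
  have ha1 : ∀ I, ContDiffAt ℝ 1 (fun p : E n × E n => a I p.1) (u, y) := fun I =>
    (((ha I).contDiffAt (hU.mem_nhds hu)).of_le (by exact_mod_cast le_top)).comp (u, y)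
      contDiffAt_fst
  have ha2 : ∀ I, ContDiffAt ℝ 1 (fun p : E n × E n => fderiv ℝ (a I) p.1) (u, y) := fun I =>
    ContDiffAt.comp (u, y) (((ha I).contDiffAt (hU.mem_nhds hu)).fderiv_right (m := 1)
      (by rw [one_add_one_eq_two]; exact ENat.LEInfty.out)) contDiffAt_fst
  have hc : ∀ i : Fin n, ContDiffAt ℝ 1 (fun p : E n × E n => p.2 i) (u, y) := fun i => by
    fun_prop
  have hH : ∀ i j, ContDiffAt ℝ 1 (fun p : E n × E n => hessian a p.1 p.2 i j) (u, y) := by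
    intro i j
    simp only [hessian, Matrix.of_apply, formDeriv₂]
    refine ContDiffAt.sum fun I _ => (ha1 I).mul (ContDiffAt.sum fun s _ => ContDiffAt.mul
      (ContDiffAt.sum fun t _ => ContDiffAt.mul ?_ contDiffAt_const) contDiffAt_const)
    exact contDiffAt_prod fun k _ => hc _
  have hf : ∀ i, ContDiffAt ℝ 1 (fun p : E n × E n => force a p.1 p.2 i) (u, y) := by
    intro i
    simp only [force, form, formDeriv, coeffDeriv]
    refine ContDiffAt.sub (ContDiffAt.sum fun I _ => ContDiffAt.mul ?_ ?_)
      (ContDiffAt.sum fun I _ => ContDiffAt.mul ?_ (ContDiffAt.sum fun s _ =>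
        ContDiffAt.mul ?_ contDiffAt_const))
    · exact (ha2 I).clm_apply contDiffAt_const
    · exact contDiffAt_prod fun k _ => hc _
    · exact (ha2 I).clm_apply contDiffAt_snd
    · exact contDiffAt_prod fun k _ => hc _
  rw [contDiffAt_euclidean]
  intro i
  simp only [acceleration, Matrix.cramer_apply]
  refine ContDiffAt.div (contDiffAt_det fun j k => ?_) (contDiffAt_det hH) h
  by_cases hk : k = i
  · simpa only [Matrix.updateCol_apply, hk, if_true] using hf j
  · simpa only [Matrix.updateCol_apply, hk, if_false] using hH j k

/-- Through every point of `U` runs a unit-speed geodesic in each direction with `|T| = 1`. It is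
given with its velocity `y` and acceleration `z`. -/
theorem exists_geodesic [NeZero m] (hm : 2 ≤ m) {a : (Fin m → Fin n) → E n → ℝ}
    {U : Set (E n)} (hU : IsOpen U) (ha : ∀ I, ContDiffOn ℝ ∞ (a I) U)
    (hg : ∀ u ∈ U, ∀ y, T a u y ≠ 0 → (g a u y).det ≠ 0)
    {u₀ y₀ : E n} (hu₀ : u₀ ∈ U) (hT₀ : |T a u₀ y₀| = 1) :
    ∃ (J : Set ℝ) (x y z : ℝ → E n), IsOpen J ∧ J.OrdConnected ∧ 0 ∈ J ∧ x 0 = u₀ ∧ y 0 = y₀ ∧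
      (∀ t ∈ J, HasDerivAt x (y t) t) ∧ (∀ t ∈ J, HasDerivAt y (z t) t) ∧
      (∀ t ∈ J, GeodesicEqAt a (x t) (y t) (z t)) ∧ IsUnitSpeedGeodesic a U J x := by
  have hT0 : T a u₀ y₀ ≠ 0 := by
    intro h
    simp [h] at hT₀
  have hvf : ContDiffAt ℝ 1 (fun p : E n × E n => (p.2, acceleration a p.1 p.2)) (u₀, y₀) :=
    contDiffAt_snd.prodMk
      (contDiffAt_acceleration hU ha hu₀ (hessian_det_ne_zero hm hT0 (hg _ hu₀ _ hT0)))
  obtain ⟨α, hα0, ε, hε, hα⟩ :=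
    hvf.exists_forall_mem_closedBall_exists_eq_forall_mem_Ioo_hasDerivAt₀ 0
  simp only [zero_sub, zero_add] at hα
  have hnhds : {p : E n × E n | p.1 ∈ U ∧ T a p.1 p.2 ≠ 0} ∈ nhds (u₀, y₀) := by
    have hTc : ContinuousAt (fun p : E n × E n => T a p.1 p.2) (u₀, y₀) := by
      unfold T
      refine tendsto_finsetSum _ fun I _ => ContinuousAt.mul ?_ ?_
      · exact ContinuousAt.comp (f := Prod.fst) (g := a I)
          (((ha I).continuousOn).continuousAt (hU.mem_nhds hu₀)) continuousAt_fst
      · fun_prop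
    exact Filter.inter_mem (continuousAt_fst.preimage_mem_nhds (hU.mem_nhds hu₀))
      (hTc.eventually_ne hT0)
  have hcont : ContinuousAt α 0 := (hα 0 ⟨by linarith, hε⟩).continuousAt
  rw [← hα0] at hnhds
  obtain ⟨δ, hδ, hball⟩ := Metric.mem_nhds_iff.1 (hcont.preimage_mem_nhds hnhds)
  set J : Set ℝ := Set.Ioo (-min ε δ) (min ε δ) with hJdef
  have hJ : IsOpen J := isOpen_Ioo
  have hJc : J.OrdConnected := Set.ordConnected_Ioo
  have h0J : (0 : ℝ) ∈ J := by
    have := lt_min hε hδ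
    exact ⟨by linarith, this⟩
  have hαJ : ∀ t ∈ J, HasDerivAt α ((α t).2, acceleration a (α t).1 (α t).2) t := fun t ht =>
    hα t ⟨by linarith [ht.1, min_le_left ε δ], by linarith [ht.2, min_le_left ε δ]⟩
  have hmem : ∀ t ∈ J, (α t).1 ∈ U ∧ T a (α t).1 (α t).2 ≠ 0 := by
    intro t ht
    refine hball (?_ : t ∈ Metric.ball 0 δ)
    rw [Metric.mem_ball, dist_zero_right, Real.norm_eq_abs, abs_lt]
    exact ⟨by linarith [ht.1, min_le_right ε δ], by linarith [ht.2, min_le_right ε δ]⟩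
  have hx : ∀ t ∈ J, HasDerivAt (fun t => (α t).1) (α t).2 t := fun t ht =>
    (hasFDerivAt_fst (p := α t)).comp_hasDerivAt t (hαJ t ht)
  have hy : ∀ t ∈ J, HasDerivAt (fun t => (α t).2) (acceleration a (α t).1 (α t).2) t :=
    fun t ht => (hasFDerivAt_snd (p := α t)).comp_hasDerivAt t (hαJ t ht)
  have hdet : ∀ t ∈ J, (hessian a (α t).1 (α t).2).det ≠ 0 := fun t ht =>
    hessian_det_ne_zero hm (hmem t ht).2 (hg _ (hmem t ht).1 _ (hmem t ht).2)
  have hgeo : ∀ t ∈ J, GeodesicEqAt a (α t).1 (α t).2 (acceleration a (α t).1 (α t).2) :=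
    fun t ht => geodesicEqAt_acceleration (hdet t ht)
  have had : ∀ t ∈ J, ∀ I, DifferentiableAt ℝ (a I) (α t).1 := fun t ht I =>
    ((ha I).differentiableOn (by simp)).differentiableAt (hU.mem_nhds (hmem t ht).1)
  have hT : ∀ t ∈ J, |T a (α t).1 (α t).2| = 1 := by
    intro t ht
    have hconst : T a (α t).1 (α t).2 = T a (α 0).1 (α 0).2 := by
      refine is_const_of_hasDerivAt_zero hJ hJc (f := fun t => T a (α t).1 (α t).2) ?_ ht h0J
      intro s hs
      have := hasDerivAt_form (hasDerivAt_coeff_comp (x := fun t => (α t).1) (had s hs) (hx s hs))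
        (hy s hs)
      rwa [(hgeo s hs).form_add_formDeriv hm] at this
    rw [hconst, hα0, hT₀]
  have hderiv : ∀ t ∈ J, deriv (fun t => (α t).1) t = (α t).2 := fun t ht => (hx t ht).deriv
  have hdy : ∀ t ∈ J, HasDerivAt (deriv fun t => (α t).1) (acceleration a (α t).1 (α t).2) t := by
    intro t ht
    refine (hy t ht).congr_of_eventuallyEq ?_
    filter_upwards [hJ.mem_nhds ht] with s hs using hderiv s hs
  have hzc : ContinuousOn (fun t => acceleration a (α t).1 (α t).2) J := fun t ht =>
    (ContinuousAt.comp (f := α) (g := fun p : E n × E n => acceleration a p.1 p.2)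
      (contDiffAt_acceleration hU ha (hmem t ht).1 (hdet t ht)).continuousAt
      (hαJ t ht).continuousAt).continuousWithinAt
  refine ⟨J, fun t => (α t).1, fun t => (α t).2, fun t => acceleration a (α t).1 (α t).2, hJ, hJc,
    h0J, by simp [hα0], by simp [hα0], hx, hy, hgeo, ⟨fun t ht => (hmem t ht).1, ?_, ?_, ?_⟩⟩
  · refine (contDiffOn_succ_iff_deriv_of_isOpen (n := 1) hJ).2
      ⟨fun t ht => (hx t ht).differentiableAt.differentiableWithinAt, by simp, ?_⟩
    refine (contDiffOn_succ_iff_deriv_of_isOpen (n := 0) hJ).2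
      ⟨fun t ht => (hdy t ht).differentiableAt.differentiableWithinAt, by simp, ?_⟩
    exact contDiffOn_zero.2 (hzc.congr fun t ht => (hdy t ht).deriv)
  · intro t ht
    rw [hderiv t ht, ← abs_T_eq_one_iff_F_eq_one]
    exact hT t ht
  · intro t ht
    refine (eulerLagrange_iff hJ ht (had t ht) ?_ (hdy t ht) ?_).2 ?_
    · rw [hderiv t ht]
      exact hx t ht
    · intro s hs
      rw [hderiv s hs]
      exact hT s hs
    · rw [hderiv t ht]
      exact hgeo t ht

/-! ### Hamel's condition from straight geodesics -/

theorem coeffDeriv_smul (a : (Fin m → Fin n) → E n → ℝ) (u v : E n) (r : ℝ) :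
    coeffDeriv a u (r • v) = r • coeffDeriv a u v := by
  funext I
  simp [coeffDeriv]

theorem HamelAt.of_smul [NeZero m] {a : (Fin m → Fin n) → E n → ℝ} {u y : E n} {r : ℝ}
    (hr : r ≠ 0) (h : HamelAt a u (r • y)) : HamelAt a u y := by
  intro i
  have h1 := h i
  -- Both sides have degree `2m` in `y`.
  have h2 : r ^ m = r * r ^ (m - 1) := (mul_pow_sub_one (NeZero.ne m) r).symm
  simp only [coeffDeriv_smul, form_smul_left, formDeriv_smul_coeff, form_smul,
    formDeriv_smul_left, h2] at h1
  have h3 : r * r ^ (m - 1) * (r * r ^ (m - 1)) ≠ 0 := by positivity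
  refine mul_left_cancel₀ h3 ?_
  linear_combination h1

/-- Hamel's condition is polynomial in `y`, so that it holds for all `y` if it holds for those `y`
at which the nonzero polynomial `T` does not vanish. -/
theorem hamelAt_of_T_ne_zero {a : (Fin m → Fin n) → E n → ℝ} {u : E n}
    (hnz : ∃ y, T a u y ≠ 0) (h : ∀ y, T a u y ≠ 0 → HamelAt a u y) (y : E n) :
    HamelAt a u y := by
  intro i
  obtain ⟨p, hp⟩ := exists_eval_eq_form fun I => MvPolynomial.C (σ := Fin n) (a I u)
  obtain ⟨p', hp'⟩ := exists_eval_eq_formDeriv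
    (fun I => MvPolynomial.C (σ := Fin n) (a I u)) (EuclideanSpace.single i 1)
  have hD : ∀ (y : E n) (I : Fin m → Fin n), MvPolynomial.eval y.ofLp
      (∑ k, MvPolynomial.C (pd k (a I) u) * MvPolynomial.X k) = coeffDeriv a u y I := by
    intro y I
    rw [coeffDeriv_eq_sum]
    simp
  obtain ⟨q, hq⟩ := exists_eval_eq_form fun I : Fin m → Fin n =>
    ∑ k, MvPolynomial.C (pd k (a I) u) * MvPolynomial.X k
  obtain ⟨q', hq'⟩ := exists_eval_eq_formDeriv (fun I : Fin m → Fin n =>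
    ∑ k, MvPolynomial.C (pd k (a I) u) * MvPolynomial.X k) (EuclideanSpace.single i 1)
  obtain ⟨s, hs⟩ := exists_eval_eq_form fun I : Fin m → Fin n =>
    MvPolynomial.C (σ := Fin n) (coeffDeriv a u (EuclideanSpace.single i 1) I)
  simp only [hD, MvPolynomial.eval_C] at hp hp' hq hq' hs
  let d : MvPolynomial (Fin n) ℝ :=
    MvPolynomial.C (m : ℝ) * p * (q' - s) - MvPolynomial.C ((m : ℝ) - 1) * p' * q
  have hd : ∀ y : E n, MvPolynomial.eval y.ofLp d
      = m * form (fun I => a I u) y *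
          (formDeriv (coeffDeriv a u y) y (EuclideanSpace.single i 1) -
            form (coeffDeriv a u (EuclideanSpace.single i 1)) y) -
        (m - 1) * formDeriv (fun I => a I u) y (EuclideanSpace.single i 1) *
          form (coeffDeriv a u y) y := by
    intro y
    simp only [d, map_sub, map_mul, MvPolynomial.eval_C, hp, hp', hq, hq']
    rw [hs]
  have hpd : p * d = 0 := by
    refine MvPolynomial.funext fun v => ?_
    rw [map_mul, map_zero]
    have hpv := hp (WithLp.toLp 2 v)
    have hdv := hd (WithLp.toLp 2 v)
    by_cases hv : T a u (WithLp.toLp 2 v) = 0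
    · exact mul_eq_zero_of_left (hpv.trans hv) _
    · exact mul_eq_zero_of_right _ (hdv.trans (sub_eq_zero.2 (h _ hv i)))
  have hp0 : p ≠ 0 := by
    rintro rfl
    obtain ⟨y, hy⟩ := hnz
    exact hy ((hp y).symm.trans (map_zero _))
  have hd0 := (mul_eq_zero.1 hpd).resolve_left hp0
  rw [← sub_eq_zero, ← hd y, hd0, map_zero]

/-- If the geodesics are straight, then Hamel's condition holds: it is read off at time `0` from
the geodesic with given position and velocity. -/
theorem hamelAt_of_geodesicsStraight [NeZero m] (hm : 2 ≤ m) {a : (Fin m → Fin n) → E n → ℝ}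
    {U : Set (E n)} (hU : IsOpen U) (ha : ∀ I, ContDiffOn ℝ ∞ (a I) U)
    (hnz : ∀ u ∈ U, ∃ y, T a u y ≠ 0)
    (hg : ∀ u ∈ U, ∀ y, T a u y ≠ 0 → (g a u y).det ≠ 0)
    (h : GeodesicsStraight a U) : ∀ u ∈ U, ∀ y, HamelAt a u y := by
  intro u hu
  refine hamelAt_of_T_ne_zero (hnz u hu) fun y hy => ?_
  -- Rescale `y` to unit length.
  have hF : 0 < F a u y := Real.rpow_pos_of_pos (abs_pos.2 hy) _
  have hFm : F a u y ^ m = |T a u y| := by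
    rw [F, ← Real.rpow_natCast, ← Real.rpow_mul (abs_nonneg _),
      one_div_mul_cancel (NeZero.ne (m : ℝ)), Real.rpow_one]
  have hT : |T a u ((F a u y)⁻¹ • y)| = 1 := by
    have h1 : T a u ((F a u y)⁻¹ • y) = (F a u y)⁻¹ ^ m * T a u y := form_smul _ _ _
    rw [h1, abs_mul, abs_of_pos (by positivity), ← hFm, ← mul_pow, inv_mul_cancel₀ hF.ne', one_pow]
  refine HamelAt.of_smul (inv_ne_zero hF.ne') ?_
  obtain ⟨J, x, y', z, hJ, hJc, h0, hx0, hy0, hx, hy', hgeo, hgeod⟩ :=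
    exists_geodesic hm hU ha hg hu hT
  have hne : y' 0 ≠ 0 := by
    rw [hy0]
    refine ne_zero_of_T_ne_zero (a := a) (u := u) ?_
    rw [← abs_pos, hT]
    exact one_pos
  obtain ⟨r, hr⟩ := exists_smul_of_collinear hJ hx hy' (h J x hJ hJc hgeod) h0 hne
  have h1 := hgeo 0 h0
  rw [hr, hx0, hy0] at h1
  exact h1.hamelAt hm

theorem geodesicsStraight_iff [NeZero m] (hm : 2 ≤ m) {a : (Fin m → Fin n) → E n → ℝ}
    {U : Set (E n)} (hU : IsOpen U) (ha : ∀ I, ContDiffOn ℝ ∞ (a I) U)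
    (hsym : ∀ (σ : Equiv.Perm (Fin m)) (I : Fin m → Fin n) (u : E n),
      a (fun k => I (σ k)) u = a I u)
    (hnz : ∀ u ∈ U, ∃ y, T a u y ≠ 0)
    (hg : ∀ u ∈ U, ∀ y, T a u y ≠ 0 → (g a u y).det ≠ 0) :
    GeodesicsStraight a U ↔ CoefficientIdentity a U := by
  rw [coefficientIdentity_iff hm hsym]
  exact ⟨hamelAt_of_geodesicsStraight hm hU ha hnz hg, geodesicsStraight_of_hamelAt hm hU ha hg⟩

theorem Metric.geodesicsStraight_iff [NeZero m] (hm : 2 ≤ m) {M : Type*} [TopologicalSpace M]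
    [ChartedSpace (E n) M] (A : Metric m n M) {φ : OpenPartialHomeomorph M (E n)}
    (hφ : φ ∈ IsManifold.maximalAtlas (𝓡 n) ∞ M) :
    GeodesicsStraight (A.coeff φ) φ.target ↔ CoefficientIdentity (A.coeff φ) φ.target :=
  MthRoot.geodesicsStraight_iff hm φ.open_target (A.smooth φ hφ)
    (fun σ I u => A.symmetric (φ.symm u) σ fun k =>
      mfderiv (𝓡 n) (𝓡 n) φ.symm u (EuclideanSpace.single (I k) (1 : ℝ) : E n))
    (A.nonzero φ hφ) (A.nondegenerate φ hφ)

end MthRoot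

end

theorem mainTheorem2 {m n : ℕ} [NeZero m] (hm : 2 ≤ m) {M : Type*} [TopologicalSpace M]
    [ChartedSpace (MthRoot.E n) M] [IsManifold (𝓡 n) ∞ M] (A : MthRoot.Metric m n M) :
    (A.ProjectivelyFlat ↔
      ∀ p : M, ∃ φ ∈ IsManifold.maximalAtlas (𝓡 n) ∞ M,
        p ∈ φ.source ∧ MthRoot.CoefficientIdentity (A.coeff φ) φ.target) ∧
    ∀ φ ∈ IsManifold.maximalAtlas (𝓡 n) ∞ M,
      (MthRoot.GeodesicsStraight (A.coeff φ) φ.target ↔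
        MthRoot.CoefficientIdentity (A.coeff φ) φ.target) := by
  refine ⟨?_, fun φ hφ => A.geodesicsStraight_iff hm hφ⟩
  refine forall_congr' fun p => exists_congr fun φ => and_congr_right fun hφ => ?_
  rw [A.geodesicsStraight_iff hm hφ]
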